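/- **Theorem 2.4** (Colorful quantitative Steinitz with volume). For a positive integer $d$ and $\varepsilon>0$, let $n(d,\varepsilon)$ be the smallest non-negative integer $N$ such that every convex set $K\subset\mathbb{R}^d$ of positive finite volume contains a polytope $P\subset K$ with at most $N$ vertices and $\operatorname{vol}(P)\ge(1-\varepsilon)\operatorname{vol}(K)$. Here a polytope is the convex hull of a finite, possibly empty, set of points. Let $d$ be a positive integer, let $\varepsilon>0$, and put $m=d\cdot n(d,\varepsilon)$. If $X_1,\dots,X_m$ are sets in $\mathbb{R}^d$ and $K\subset\bigcap_{i=1}^m\operatorname{conv}(X_i)$ is a convex set of volume $1$, then there are points $x_1\in X_1,\dots,x_m\in X_m$ such that $$\operatorname{vol}(\operatorname{conv}\{x_1,\dots,x_m\})\ge 1-\varepsilon .$$ Moreover, the conclusion may fail when the number of sets is smaller than $n(d,\varepsilon)$: for every integer $0\le m<n(d,\varepsilon)$ there are sets $X_1,\dots,X_m$ in $\mathbb{R}^d$ and a convex set $K\subset\bigcap_{i=1}^m\operatorname{conv}(X_i)$ of volume $1$ such that $\operatorname{vol}(\operatorname{conv}\{x_1,\dots,x_m\})<1-\varepsilon$ for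 all choices $x_1\in X_1,\dots,x_m\in X_m$. (For $m=0$ the intersection is $\mathbb{R}^d$ and the convex hull is empty.) -/

import Mathlib

open MeasureTheory Set

/-- A (convex) polytope in `ℝ^d`: the convex hull of a finite set of points.
The empty set is a polytope (with no vertices). -/
def IsConvexPolytope {d : ℕ} (P : Set (EuclideanSpace ℝ (Fin d))) : Prop :=
  ∃ V : Finset (EuclideanSpace ℝ (Fin d)), P = convexHull ℝ (V : Set (EuclideanSpace ℝ (Fin d)))

/-- `N` vertices suffice to capture a `1 - ε` fraction of the volume: every convex set `K ⊆ ℝ^d` of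
positive finite volume contains a polytope `P` with at most `N` vertices (extreme points) such that
`vol P ≥ (1 - ε) vol K`. For `ε ≥ 1` the requirement on the volume is void. -/
def InscribedVolumeBound (d : ℕ) (ε : ℝ) (N : ℕ) : Prop :=
  ∀ K : Set (EuclideanSpace ℝ (Fin d)), Convex ℝ K → 0 < volume K → volume K < ⊤ →
    ∃ P : Set (EuclideanSpace ℝ (Fin d)), IsConvexPolytope P ∧ P ⊆ K ∧
      (P.extremePoints ℝ).encard ≤ N ∧ ENNReal.ofReal (1 - ε) * volume K ≤ volume P

/-- `n(d, ε)`: the smallest number of vertices that suffices to capture a `1 - ε` fraction of the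
volume of every convex set of positive finite volume in `ℝ^d`. -/
noncomputable def inscribedVertexNumber (d : ℕ) (ε : ℝ) : ℕ :=
  sInf {N : ℕ | InscribedVolumeBound d ε N}

/-! Take a polytope P in K with at most n = n(d, ε) vertices and volume at least 1 - ε, and fix q in
its interior (if P is null, then 1 - ε ≤ 0 and any choice works). Split the dn colours into n blocks
of d, one block per vertex. In each block, colorful Carathéodory with q as extra point
(`colorful_caratheodory_insert`) puts the vertex in the hull of q and a rainbow choice. So P lies in
the hull of q and all chosen points, and q, being interior to P, can be dropped
(`convexHull_subset_of_subset_convexHull_insert`).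

That n(d, ε) is a genuine minimum requires a bound uniform in K: an affine map places K between a
fixed simplex and a fixed cube (`exists_affine_normalization`), where one finite net serves all K
(`exists_card_bound_of_ball_subset`).

For sharpness, rescale to volume 1 a set K for which m vertices do not suffice, and let every X_i be
K. -/

/-! ### Colorful Carathéodory theorems -/

section Colorful

open scoped RealInnerProductSpace

variable {E : Type*} [NormedAddCommGroup E] [InnerProductSpace ℝ E]

/-- First-order optimality: if moving from `z` along `w` does not bring us closer to `a`, then `w`
makes a non-acute angle with `a - z`. -/
theorem inner_sub_nonpos_of_forall_norm_le {a z w : E} {τ : ℝ} (hτ : 0 < τ)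
    (h : ∀ t : ℝ, 0 < t → t ≤ τ → ‖a - z‖ ≤ ‖a - (z + t • w)‖) : ⟪a - z, w⟫ ≤ 0 := by
  by_contra! hpos
  have key : ∀ t : ℝ, 0 < t → t ≤ τ → 2 * ⟪a - z, w⟫ ≤ t * ‖w‖ ^ 2 := by
    intro t ht htτ
    have h1 := h t ht htτ
    have h2 : ‖a - z‖ ^ 2 ≤ ‖a - z - t • w‖ ^ 2 := by
      rw [sub_sub]
      gcongr
    rw [norm_sub_sq_real (a - z), inner_smul_right, norm_smul, Real.norm_eq_abs, mul_pow, sq_abs] at h2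
    have h3 : t * (2 * ⟪a - z, w⟫) ≤ t * (t * ‖w‖ ^ 2) := by nlinarith
    exact le_of_mul_le_mul_left h3 ht
  set s := ⟪a - z, w⟫
  have hw : 0 ≤ ‖w‖ ^ 2 := by positivity
  have hden : 0 < ‖w‖ ^ 2 + 1 := by positivity
  -- For this step length the quadratic term is at most `s`, too small to offset the linear term `2
  -- * s`.
  have hm : 0 < min τ (s / (‖w‖ ^ 2 + 1)) := by positivity
  have h1 := key _ hm (min_le_left _ _)
  have h2 : min τ (s / (‖w‖ ^ 2 + 1)) * ‖w‖ ^ 2 ≤ s / (‖w‖ ^ 2 + 1) * (‖w‖ ^ 2 + 1) := by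
    gcongr
    · exact min_le_right _ _
    · linarith
  rw [div_mul_cancel₀ _ hden.ne'] at h2
  linarith

/-- The cone spanned by a linearly independent family is closed. -/
theorem isClosed_simplicial_cone [FiniteDimensional ℝ E] {κ : Type*} [Fintype κ] {v : κ → E}
    (hv : LinearIndependent ℝ v) : IsClosed {x : E | ∃ c : κ → ℝ, 0 ≤ c ∧ ∑ i, c i • v i = x} := by
  have hinj : LinearMap.ker (Fintype.linearCombination ℝ v) = ⊥ := by
    rw [LinearMap.ker_eq_bot]
    exact linearIndependent_iff_injective_fintypeLinearCombination.1 hv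
  have hc := (LinearMap.isClosedEmbedding_of_injective hinj).isClosedMap (Ici 0) isClosed_Ici
  convert hc using 1
  ext x
  rfl

/-- Bárány's colorful Carathéodory theorem for cones, with the hypothesis `a ∈ cone (V i)` in its
dual form. -/
theorem colorful_caratheodory_cone [FiniteDimensional ℝ E] {ι : Type*} [Fintype ι] [DecidableEq ι]
    (hι : Fintype.card ι = Module.finrank ℝ E) (V : ι → Set E) (hfin : ∀ i, (V i).Finite)
    (hne : ∀ i, (V i).Nonempty)
    (a : E) (h : ∀ i n, 0 < ⟪n, a⟫ → ∃ v ∈ V i, 0 < ⟪n, v⟫) :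
    ∃ v : ι → E, (∀ i, v i ∈ V i) ∧ ∃ c : ι → ℝ, (∀ i, 0 ≤ c i) ∧ ∑ i, c i • v i = a := by
  let cone : (ι → E) × Finset ι → Set E := fun p =>
    {x | ∃ c : p.2 → ℝ, 0 ≤ c ∧ ∑ i, c i • p.1 i = x}
  -- Linear independence makes each rainbow cone closed. There are finitely many, so some point `z`
  -- of their union is nearest to `a`; if `z ≠ a`, exchanging one colour gets closer.
  let I : Set ((ι → E) × Finset ι) :=
    {p | p.1 ∈ Set.univ.pi V ∧ LinearIndependent ℝ (fun i : p.2 => p.1 i)}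
  have hI : I.Finite :=
    ((Set.Finite.pi' hfin).prod (Set.finite_univ (α := Finset ι))).subset fun p hp =>
      ⟨fun i => hp.1 i trivial, trivial⟩
  have hclosed : IsClosed (⋃ p ∈ I, cone p) :=
    hI.isClosed_biUnion fun p hp => isClosed_simplicial_cone hp.2
  choose v₀ hv₀ using hne
  have hnon : (⋃ p ∈ I, cone p).Nonempty := by
    refine ⟨0, mem_biUnion (x := (v₀, ∅)) ⟨fun i _ => hv₀ i, ?_⟩ ⟨0, le_rfl, by simp⟩⟩
    exact linearIndependent_empty_type
  obtain ⟨z, hz, hza⟩ := hclosed.exists_infDist_eq_dist hnon a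
  have hmin : ∀ y ∈ ⋃ p ∈ I, cone p, ‖a - z‖ ≤ ‖a - y‖ := by
    intro y hy
    rw [← dist_eq_norm, ← dist_eq_norm, ← hza]
    exact Metric.infDist_le_dist_of_mem hy
  obtain ⟨⟨v, S⟩, ⟨hvV, hvS⟩, c, hc0, hcz⟩ := mem_iUnion₂.1 hz
  simp only at hvV hvS hc0 hcz c
  -- extend the coefficients by zero
  let e : ι → ℝ := fun i => if hi : i ∈ S then c ⟨i, hi⟩ else 0
  have he0 : ∀ i, 0 ≤ e i := by
    intro i
    by_cases hi : i ∈ S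
    · simpa [e, hi] using hc0 ⟨i, hi⟩
    · simp [e, hi]
  have heS : ∀ i, e i ≠ 0 → i ∈ S := by
    intro i hi
    by_contra hn
    exact hi (by simp [e, hn])
  have hez : ∑ i, e i • v i = z := by
    rw [← hcz, ← Finset.sum_subset (Finset.subset_univ S), ← Finset.sum_coe_sort S]
    · exact Finset.sum_congr rfl fun i _ => by simp [e]
    · intro i _ hi
      simp [e, hi]
  have mem_of : ∀ (u : ι → E) (T : Finset ι) (f : ι → ℝ), (∀ i, u i ∈ V i) →
      LinearIndependent ℝ (fun i : T => u i) → (∀ i, 0 ≤ f i) → (∀ i, f i ≠ 0 → i ∈ T) →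
      ∑ i, f i • u i ∈ ⋃ p ∈ I, cone p := by
    intro u T f hu hT hf hfT
    refine mem_biUnion (x := (u, T)) ⟨fun i _ => hu i, hT⟩ ⟨fun i => f i, fun i => hf i, ?_⟩
    rw [← Finset.sum_subset (Finset.subset_univ T)]
    · exact Finset.sum_coe_sort T fun i => f i • u i
    · intro i _ hi
      rw [not_imp_comm.1 (hfT i) hi, zero_smul]
  refine ⟨v, fun i => hvV i trivial, e, he0, ?_⟩
  by_contra hne'
  rw [hez] at hne'
  set n := a - z with hn
  have hn0 : n ≠ 0 := fun h0 => hne' (sub_eq_zero.1 h0).symm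
  -- Only on the support of `e` can `z` move both ways along `v i` without leaving the cone; this
  -- forces `n` to be orthogonal to those `v i`.
  let T : Finset ι := Finset.univ.filter fun i => e i ≠ 0
  have hTS : T ⊆ S := fun i hi => heS i (Finset.mem_filter.1 hi).2
  have horth : ∀ i ∈ T, ⟪n, v i⟫ = 0 := by
    intro i hi
    have hei : 0 < e i := lt_of_le_of_ne (he0 i) (Ne.symm (Finset.mem_filter.1 hi).2)
    have move : ∀ t : ℝ, -e i ≤ t → ‖a - z‖ ≤ ‖a - (z + t • v i)‖ := by
      intro t ht
      apply hmin
      have : z + t • v i = ∑ j, (e j + if j = i then t else 0) • v j := by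
        simp [add_smul, Finset.sum_add_distrib, hez, ite_smul]
      rw [this]
      refine mem_of v S _ (fun j => hvV j trivial) hvS ?_ ?_
      · intro j
        split_ifs with hj
        · subst hj; linarith
        · simpa using he0 j
      · intro j hj
        by_cases hji : j = i
        · exact hji ▸ hTS hi
        · exact heS j (by simpa [hji] using hj)
    apply le_antisymm
    · exact inner_sub_nonpos_of_forall_norm_le one_pos fun t ht _ => move t (by linarith)
    · have := inner_sub_nonpos_of_forall_norm_le (a := a) (z := z) (w := -v i) hei
        fun t ht hte => by
          have := move (-t) (by linarith)
          rwa [neg_smul, ← smul_neg] at this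
      rw [inner_neg_right] at this
      linarith
  have hnz : ⟪n, z⟫ = 0 := by
    rw [← hez, inner_sum]
    refine Finset.sum_eq_zero fun i _ => ?_
    rw [inner_smul_right]
    by_cases hi : e i = 0
    · rw [hi, zero_mul]
    · rw [horth i (Finset.mem_filter.2 ⟨Finset.mem_univ _, hi⟩), mul_zero]
  have hna : 0 < ⟪n, a⟫ := by
    have : a = n + z := by rw [hn]; abel
    rw [this, inner_add_right, hnz, add_zero, real_inner_self_eq_norm_sq]
    positivity
  have hTind : LinearIndependent ℝ (fun i : T => v i) :=
    hvS.comp (fun i : T => (⟨i, hTS i.2⟩ : S)) fun i j hij => by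
      exact Subtype.ext (congrArg (fun s : S => (s : ι)) hij)
  have hspan : Submodule.span ℝ (Set.range fun i : T => v i) ≤ (ℝ ∙ n)ᗮ := by
    rw [Submodule.span_le]
    rintro _ ⟨i, rfl⟩
    exact Submodule.mem_orthogonal_singleton_iff_inner_right.2 (horth i i.2)
  -- With every colour in use, the `v i` would be a basis orthogonal to `n ≠ 0`.
  obtain ⟨i, hi⟩ : ∃ i, i ∉ T := by
    by_contra! hall
    have hcard : T.card = Module.finrank ℝ E := by
      rw [← hι, Finset.eq_univ_iff_forall.2 hall, Finset.card_univ]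
    have htop : Submodule.span ℝ (Set.range fun i : T => v i) = ⊤ :=
      hTind.span_eq_top_of_card_eq_finrank' (by simpa using hcard)
    have : n ∈ (ℝ ∙ n)ᗮ := hspan (htop ▸ Submodule.mem_top)
    rw [Submodule.mem_orthogonal_singleton_iff_inner_right, inner_self_eq_zero] at this
    exact hn0 this
  obtain ⟨u, huV, hnu⟩ := h i n hna
  have hei : e i = 0 := by simpa [T] using hi
  have hupd : ∀ j ∈ T, Function.update v i u j = v j := fun j hj =>
    Function.update_of_ne (fun hji => hi (by rwa [← hji])) _ _
  -- `u` is not orthogonal to `n`, whereas the span of the `v j`, `j ∈ T`, is; so the free colour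
  -- `i` can take `u` and the cone stays admissible.
  have hind : LinearIndependent ℝ (fun j : (insert i T : Finset ι) => Function.update v i u j) := by
    have h1 : LinearIndepOn ℝ (Function.update v i u) (T : Set ι) := by
      refine LinearIndepOn.congr (v := v) hTind fun j hj => (hupd j hj).symm
    have h2 : LinearIndepOn ℝ (Function.update v i u) (insert i (T : Set ι)) := by
      refine h1.insert ?_
      rw [Function.update_self]
      intro hu
      have himg : Function.update v i u '' (T : Set ι) = Set.range fun j : T => v j := by
        ext y
        constructor
        · rintro ⟨j, hj, rfl⟩
          exact ⟨⟨j, hj⟩, (hupd j hj).symm⟩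
        · rintro ⟨j, rfl⟩
          exact ⟨j, j.2, hupd j j.2⟩
      rw [himg] at hu
      have := Submodule.mem_orthogonal_singleton_iff_inner_right.1 (hspan hu)
      exact hnu.ne' this
    rw [← Finset.coe_insert] at h2
    exact h2
  refine hnu.not_ge (inner_sub_nonpos_of_forall_norm_le one_pos fun t ht _ => hmin _ ?_)
  have hsum : z + t • u = ∑ j, (e j + if j = i then t else 0) • Function.update v i u j := by
    have h1 : ∑ j, e j • Function.update v i u j = z := by
      rw [← hez]
      refine Finset.sum_congr rfl fun j _ => ?_
      by_cases hj : j = i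
      · rw [hj, hei, zero_smul, zero_smul]
      · rw [Function.update_of_ne hj]
    simp [add_smul, Finset.sum_add_distrib, h1, ite_smul]
  rw [hsum]
  refine mem_of _ (insert i T) _ ?_ hind ?_ ?_
  · intro j
    by_cases hj : j = i
    · subst hj; simpa using huV
    · simpa [hj] using hvV j trivial
  · intro j
    have := he0 j
    split_ifs <;> linarith
  · intro j hj
    by_cases hji : j = i
    · simp [hji]
    · simp only [hji, if_false, add_zero] at hj
      exact Finset.mem_insert_of_mem (Finset.mem_filter.2 ⟨Finset.mem_univ _, hj⟩)

/-- Colorful Carathéodory with a prescribed vertex: if `x` lies in the convex hulls of `dim E` sets,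
then for every `q` some rainbow choice together with `q` has `x` in its convex hull. -/
theorem colorful_caratheodory_insert [FiniteDimensional ℝ E] {ι : Type*} [Fintype ι]
    [DecidableEq ι] (hι : Fintype.card ι = Module.finrank ℝ E) (V : ι → Set E) (x q : E)
    (hx : ∀ i, x ∈ convexHull ℝ (V i)) :
    ∃ v : ι → E, (∀ i, v i ∈ V i) ∧ x ∈ convexHull ℝ (insert q (Set.range v)) := by
  have hfin : ∀ i, ∃ t : Finset E, ↑t ⊆ V i ∧ x ∈ convexHull ℝ (t : Set E) := by
    intro i
    have := hx i
    rw [convexHull_eq_union_convexHull_finite_subsets] at this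
    simpa using this
  choose t htV hxt using hfin
  let U : Set E := ⋃ v ∈ {v : ι → E | ∀ i, v i ∈ (t i : Set E)}, convexHull ℝ (insert q (Set.range v))
  have hUfin : {v : ι → E | ∀ i, v i ∈ (t i : Set E)}.Finite :=
    Set.Finite.pi' fun i => (t i).finite_toSet
  have hU : IsClosed U := hUfin.isClosed_biUnion fun v _ =>
    Set.Finite.isClosed_convexHull (𝕜 := ℝ) ((Set.finite_range v).insert q)
  suffices hxU : x ∈ U by
    obtain ⟨v, hv, hxv⟩ := mem_iUnion₂.1 hxU
    exact ⟨v, fun i => htV i (hv i), hxv⟩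
  -- `U` is closed, so approximating `x` suffices, which leaves room for a perturbation.
  rw [← hU.closure_eq, Metric.mem_closure_iff]
  intro ρ hρ
  set p := q - x with hp
  obtain ⟨δ, hδ, hδρ⟩ : ∃ δ : ℝ, 0 < δ ∧ δ * ‖p‖ < ρ := by
    refine ⟨ρ / (‖p‖ + 1), by positivity, ?_⟩
    rw [div_mul_eq_mul_div, div_lt_iff₀ (by positivity)]
    nlinarith
  -- As `x` is in the hull of `t i`, some `y` there has `⟪n, y - x⟫ ≥ 0`; the shift by `-δ • p`
  -- makes this strict whenever `⟪n, -p⟫ > 0`.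
  obtain ⟨w, hw, c, hc0, hc⟩ := colorful_caratheodory_cone hι
    (fun i => (fun y => y - x - δ • p) '' (t i : Set E)) (fun i => (t i).finite_toSet.image _)
    (fun i => (convexHull_nonempty_iff.1 ⟨x, hxt i⟩).image _) (-p) (by
      intro i n hn
      by_contra! hcon
      have hsub : convexHull ℝ (t i : Set E) ⊆ {y | ⟪n, y⟫ ≤ ⟪n, x⟫ + δ * ⟪n, p⟫} := by
        refine convexHull_min ?_ (convex_halfSpace_le (𝕜 := ℝ) (innerSL ℝ n).toLinearMap.isLinear _)
        intro y hy
        have := hcon _ ⟨y, hy, rfl⟩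
        simp only [inner_sub_right, inner_smul_right] at this
        simp only [mem_ofPred_eq]
        linarith
      have := hsub (hxt i)
      simp only [mem_ofPred_eq] at this
      rw [inner_neg_right] at hn
      nlinarith)
  choose v hvt hvw using hw
  have hc' : ∑ i, c i • (v i - x - δ • p) = -p := by
    rw [← hc]
    exact Finset.sum_congr rfl fun i _ => by rw [← hvw i]
  set s := ∑ i, c i with hs
  have hs0 : 0 ≤ s := Finset.sum_nonneg fun i _ => hc0 i
  have hsum : ∑ i, c i • v i = s • x + (δ * s - 1) • p := by
    have : ∑ i, c i • (v i - x - δ • p) = ∑ i, c i • v i - s • x - s • δ • p := by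
      simp only [smul_sub, Finset.sum_sub_distrib, ← Finset.sum_smul, hs]
    rw [this] at hc'
    have h2 : ∑ i, c i • v i = s • x + s • δ • p + (∑ i, c i • v i - s • x - s • δ • p) := by abel
    rw [h2, hc']
    module
  have hvU : convexHull ℝ (insert q (Set.range v)) ⊆ U := fun y hy => mem_biUnion hvt hy
  have hconv := convex_convexHull ℝ (insert q (Set.range v))
  have hmem : ∀ i, v i ∈ convexHull ℝ (insert q (Set.range v)) := fun i =>
    subset_convexHull _ _ (mem_insert_of_mem _ ⟨i, rfl⟩)
  have hqmem : q ∈ convexHull ℝ (insert q (Set.range v)) :=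
    subset_convexHull _ _ (mem_insert _ _)
  rcases hs0.eq_or_lt with hs00 | hspos
  · -- all coefficients vanish, so `p = 0`
    have hczero : ∀ i, c i = 0 := fun i =>
      (Finset.sum_eq_zero_iff_of_nonneg fun j _ => hc0 j).1 (hs ▸ hs00.symm) i (Finset.mem_univ i)
    have hp0 : p = 0 := by simpa [hczero] using hc'.symm
    have hqx : q = x := sub_eq_zero.1 hp0
    exact ⟨q, hvU hqmem, by simpa [hqx] using hρ⟩
  · have hy : ∑ i, (c i / s) • v i ∈ convexHull ℝ (insert q (Set.range v)) :=
      hconv.sum_mem (fun i _ => div_nonneg (hc0 i) hs0)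
        (by rw [← Finset.sum_div, div_self hspos.ne']) fun i _ => hmem i
    -- The normalized combination lies on the line through `x` and `q`: either `x` is between it and
    -- `q`, or it is within `δ * ‖p‖` of `x`.
    have hyeq : ∑ i, (c i / s) • v i = x + (δ - 1 / s) • p := by
      have : ∑ i, (c i / s) • v i = s⁻¹ • ∑ i, c i • v i := by
        rw [Finset.smul_sum]
        exact Finset.sum_congr rfl fun i _ => by rw [smul_smul, div_eq_inv_mul]
      rw [this, hsum, smul_add, smul_smul, smul_smul, inv_mul_cancel₀ hspos.ne', one_smul]
      congr 2
      field_simp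
    rw [hyeq] at hy
    rcases le_total (δ * s) 1 with h1 | h1
    · refine ⟨x, hvU ?_, by simpa using hρ⟩
      -- `x` lies on the segment between that point and `q`
      have hden : 0 < 1 + (1 / s - δ) := by
        have : δ ≤ 1 / s := by rwa [le_div_iff₀ hspos]
        linarith
      have hle : 0 ≤ 1 / s - δ := sub_nonneg.2 (by rwa [le_div_iff₀ hspos])
      have := hconv hy hqmem (a := 1 / (1 + (1 / s - δ))) (b := (1 / s - δ) / (1 + (1 / s - δ)))
        (by positivity) (by positivity) (by rw [← add_div, div_self hden.ne'])
      convert this using 1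
      have hq : q = x + p := by rw [hp]; abel
      rw [hq]
      set r := 1 / s - δ with hr
      have : δ - 1 / s = -r := by rw [hr]; ring
      rw [this]
      have e1 : (1 / (1 + r)) • (x + -r • p) + (r / (1 + r)) • (x + p)
          = (1 / (1 + r) + r / (1 + r)) • x + (r / (1 + r) - r * (1 / (1 + r))) • p := by module
      rw [e1, ← add_div, div_self hden.ne', one_smul, mul_one_div, sub_self, zero_smul, add_zero]
    · refine ⟨_, hvU hy, ?_⟩
      rw [dist_eq_norm, sub_add_cancel_left, norm_neg, norm_smul, Real.norm_eq_abs]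
      refine lt_of_le_of_lt ?_ hδρ
      gcongr
      have h2 : 1 / s ≤ δ := by rwa [div_le_iff₀ hspos]
      have h3 : 0 < 1 / s := by positivity
      rw [abs_of_nonneg (by linarith)]
      linarith

/-- If every generator of a polytope is in the hull of `Y` and an interior point `q` of the
polytope, then `Y` alone already generates a set containing the polytope. -/
theorem convexHull_subset_of_subset_convexHull_insert {W Y : Set E} {q : E} (hY : Y.Finite)
    (hYne : Y.Nonempty) (hq : q ∈ interior (convexHull ℝ W))
    (hW : W ⊆ convexHull ℝ (insert q Y)) : convexHull ℝ W ⊆ convexHull ℝ Y := by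
  have hW' : convexHull ℝ W ⊆ convexHull ℝ (insert q Y) :=
    convexHull_min hW (convex_convexHull _ _)
  suffices hqY : q ∈ convexHull ℝ Y from
    hW'.trans (convexHull_min (insert_subset hqY (subset_convexHull _ _)) (convex_convexHull _ _))
  by_contra hqY
  obtain ⟨f, u, hfu, huq⟩ := geometric_hahn_banach_closed_point (convex_convexHull ℝ Y)
    (hY.isClosed_convexHull (𝕜 := ℝ)) hqY
  obtain ⟨y, hy⟩ := hYne
  have hfy : f y < f q := (hfu y (subset_convexHull _ _ hy)).trans huq
  have hle : convexHull ℝ (insert q Y) ⊆ {x | f x ≤ f q} := by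
    refine convexHull_min (insert_subset (le_refl (f q)) fun x hx => ?_)
      (convex_halfSpace_le f.toLinearMap.isLinear _)
    exact ((hfu x (subset_convexHull _ _ hx)).trans huq).le
  -- On the hull of `W` the functional `f` would be maximal at the interior point `q`, yet it
  -- increases from `q` in the direction `q - y`.
  have hcont : Filter.Tendsto (fun t : ℝ => q + t • (q - y)) (nhds 0) (nhds q) := by
    have : Continuous fun t : ℝ => q + t • (q - y) := by fun_prop
    simpa using this.tendsto 0
  have hev := (hcont.eventually (mem_interior_iff_mem_nhds.1 hq)).filter_mono
    (nhdsWithin_le_nhds (s := Ioi 0))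
  obtain ⟨t, ht, ht0⟩ := (hev.and self_mem_nhdsWithin).exists
  have h1 : f (q + t • (q - y)) ≤ f q := hle (hW' ht)
  simp only [map_add, map_smul, map_sub, smul_eq_mul] at h1
  have : 0 < t * (f q - f y) := mul_pos ht0 (by linarith)
  linarith

end Colorful

/-! ### Uniform approximation of convex sets by inscribed polytopes -/

section Approximation

/-- A convex set containing a ball of radius `r` about `c`, shrunk towards `c` by the factor
`1 - δ / r`, is contained in the convex hull of every finite `δ`-net. -/
theorem homothety_image_subset_convexHull_of_net {E : Type*} [NormedAddCommGroup E]
    [NormedSpace ℝ E] {K V : Set E} {c : E} {r δ : ℝ} (hV : V.Finite) (hδ : 0 < δ) (hδr : δ < r)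
    (hball : Metric.closedBall c r ⊆ K) (hnet : ∀ k ∈ K, ∃ v ∈ V, dist k v ≤ δ) :
    AffineMap.homothety c (1 - δ / r) '' K ⊆ convexHull ℝ V := by
  have hr : 0 < r := hδ.trans hδr
  rintro _ ⟨k, hk, rfl⟩
  by_contra hy
  obtain ⟨f, u, hfu, huy⟩ := geometric_hahn_banach_closed_point (convex_convexHull ℝ V)
    (hV.isClosed_convexHull (𝕜 := ℝ)) hy
  have hfK : ∀ x ∈ K, f x ≤ u + δ * ‖f‖ := by
    intro x hx
    obtain ⟨v, hv, hxv⟩ := hnet x hx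
    have h1 := (hfu v (subset_convexHull _ _ hv)).le
    have h2 : f (x - v) ≤ ‖f‖ * ‖x - v‖ := (le_abs_self _).trans (f.le_opNorm _)
    rw [← dist_eq_norm] at h2
    have h3 : ‖f‖ * dist x v ≤ ‖f‖ * δ := by gcongr
    rw [map_sub] at h2
    linarith
  have hfc := hfK c (hball (Metric.mem_closedBall_self hr.le))
  -- The ball about `c` gives `f c + r * ‖f‖ ≤ u + δ * ‖f‖`. Averaged with the bound at `k`, with
  -- weights `δ / r` and `1 - δ / r`, the terms in `‖f‖` cancel and `f` is at most `u` at the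
  -- shrunken point.
  have hnorm : ‖f‖ ≤ (u + δ * ‖f‖ - f c) / r := by
    have hle : ∀ x, f x ≤ (u + δ * ‖f‖ - f c) / r * ‖x‖ := by
      intro x
      rcases eq_or_ne x 0 with rfl | hx
      · simp
      have hx' : 0 < ‖x‖ := norm_pos_iff.2 hx
      have hmem : c + (r / ‖x‖) • x ∈ K := hball (by
        rw [Metric.mem_closedBall, dist_self_add_left, norm_smul, Real.norm_eq_abs,
          abs_of_pos (by positivity), div_mul_cancel₀ _ hx'.ne'])
      have h1 := hfK _ hmem
      rw [map_add, map_smul, smul_eq_mul, div_mul_eq_mul_div] at h1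
      have h2 : r * f x / ‖x‖ ≤ u + δ * ‖f‖ - f c := by linarith
      rw [div_le_iff₀ hx'] at h2
      rw [div_mul_eq_mul_div, le_div_iff₀ hr]
      linarith
    refine f.opNorm_le_bound (div_nonneg (by linarith) hr.le) fun x => ?_
    rw [Real.norm_eq_abs, abs_le']
    refine ⟨hle x, ?_⟩
    simpa using hle (-x)
  rw [le_div_iff₀ hr] at hnorm
  have hfk := hfK k hk
  rw [AffineMap.homothety_apply, vsub_eq_sub, vadd_eq_add, map_add, map_smul, map_sub,
    smul_eq_mul] at huy
  have ht : δ / r * r = δ := div_mul_cancel₀ _ hr.ne'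
  have ht0 : 0 < δ / r := by positivity
  have ht1 : δ / r < 1 := (div_lt_one hr).2 hδr
  set t := δ / r
  have h1 : t * (f c + r * ‖f‖) ≤ t * (u + δ * ‖f‖) := by
    apply mul_le_mul_of_nonneg_left _ ht0.le
    linarith
  have h2 : (1 - t) * f k ≤ (1 - t) * (u + δ * ‖f‖) := by
    apply mul_le_mul_of_nonneg_left hfk
    linarith
  have h3 : t * (r * ‖f‖) = δ * ‖f‖ := by rw [← mul_assoc, ht]
  nlinarith

/-- A uniform number of points suffices for approximating in volume all convex sets between a fixed
ball and a fixed larger ball. -/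
theorem exists_card_bound_of_ball_subset {E : Type*} [NormedAddCommGroup E] [NormedSpace ℝ E]
    [FiniteDimensional ℝ E] [MeasurableSpace E] [BorelSpace E] (μ : Measure E) [μ.IsAddHaarMeasure]
    (c : E) {r : ℝ} (hr : 0 < r) (R : ℝ) {ε : ℝ} (hε : 0 < ε) :
    ∃ N : ℕ, ∀ K : Set E, Metric.closedBall c r ⊆ K → K ⊆ Metric.closedBall 0 R →
      ∃ V : Finset E, ↑V ⊆ K ∧ V.card ≤ N ∧
        ENNReal.ofReal (1 - ε) * μ K ≤ μ (convexHull ℝ (V : Set E)) := by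
  classical
  set d := Module.finrank ℝ E
  -- Bernoulli's inequality; the denominator `d + 2` keeps `t < 1` even for `d = 0`.
  obtain ⟨t, ht0, ht1, htd⟩ : ∃ t : ℝ, 0 < t ∧ t < 1 ∧ 1 - ε ≤ (1 - t) ^ d := by
    have hm : 0 < min ε 1 := by positivity
    have hm1 : min ε 1 ≤ 1 := min_le_right _ _
    have hd0 : (0 : ℝ) ≤ d := Nat.cast_nonneg d
    have hlt : min ε 1 / (d + 2) < 1 := by
      rw [div_lt_one (by positivity)]
      linarith
    refine ⟨min ε 1 / (d + 2), by positivity, hlt, ?_⟩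
    have h1 := one_add_mul_le_pow (a := -(min ε 1 / ((d : ℝ) + 2))) (by linarith) d
    have h2 : (d : ℝ) * (min ε 1 / (d + 2)) ≤ ε := by
      rw [mul_div_assoc', div_le_iff₀ (by positivity)]
      have := min_le_left ε 1
      nlinarith
    rw [← sub_eq_add_neg] at h1
    linarith
  have hδ : 0 < r * t := by positivity
  obtain ⟨F, -, hF, hcov⟩ := Metric.finite_approx_of_totallyBounded
    (isCompact_closedBall (0 : E) R).totallyBounded (r * t / 2) (by positivity)
  -- The net of the large ball does not depend on `K`. Moving its centres into `K` doubles the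
  -- radius, hence the choice `r * t / 2`.
  refine ⟨hF.toFinset.card, fun K hball hK => ?_⟩
  have hrep : ∀ y : E, ∃ k : E, (K ∩ Metric.ball y (r * t / 2)).Nonempty →
      k ∈ K ∩ Metric.ball y (r * t / 2) := by
    intro y
    by_cases h : (K ∩ Metric.ball y (r * t / 2)).Nonempty
    · exact ⟨h.some, fun _ => h.some_mem⟩
    · exact ⟨0, fun h' => absurd h' h⟩
  choose g hg using hrep
  refine ⟨(hF.toFinset.filter fun y => (K ∩ Metric.ball y (r * t / 2)).Nonempty).image g, ?_,
    Finset.card_image_le.trans (Finset.card_filter_le _ _), ?_⟩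
  · intro v hv
    obtain ⟨y, hy, rfl⟩ := Finset.mem_image.1 (Finset.mem_coe.1 hv)
    exact (hg y (Finset.mem_filter.1 hy).2).1
  · have hsub := homothety_image_subset_convexHull_of_net (Finset.finite_toSet
      ((hF.toFinset.filter fun y => (K ∩ Metric.ball y (r * t / 2)).Nonempty).image g)) hδ
      (by nlinarith) hball (by
        intro k hk
        obtain ⟨y, hyF, hky⟩ := mem_iUnion₂.1 (hcov (hK hk))
        have hn : (K ∩ Metric.ball y (r * t / 2)).Nonempty := ⟨k, hk, hky⟩
        refine ⟨g y, ?_, ?_⟩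
        · exact Finset.mem_coe.2 (Finset.mem_image_of_mem _
            (Finset.mem_filter.2 ⟨hF.mem_toFinset.2 hyF, hn⟩))
        · have h1 := (hg y hn).2
          rw [Metric.mem_ball] at h1 hky
          have := dist_triangle_right k (g y) y
          linarith)
    refine le_trans ?_ (measure_mono hsub)
    rw [Measure.addHaar_image_homothety, mul_div_cancel_left₀ _ hr.ne']
    gcongr
    exact htd.trans (le_abs_self _)

theorem volume_image_affine {d : ℕ} (M : EuclideanSpace ℝ (Fin d) →ₗ[ℝ] EuclideanSpace ℝ (Fin d))
    (p : EuclideanSpace ℝ (Fin d)) (S : Set (EuclideanSpace ℝ (Fin d))) :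
    volume ((fun x => p + M x) '' S) = ENNReal.ofReal |LinearMap.det M| * volume S := by
  rw [← Measure.addHaar_image_linearMap, ← measure_preimage_add volume p]
  congr 1
  ext y
  simp

/-- The standard basis of `ℝ^d`. -/
noncomputable abbrev euclideanBasis (d : ℕ) : Module.Basis (Fin d) ℝ (EuclideanSpace ℝ (Fin d)) :=
  (EuclideanSpace.basisFun (Fin d) ℝ).toBasis

/-- The corner simplex with vertices `0, e₁, …, e_d`. -/
def cornerSimplex (d : ℕ) : Set (EuclideanSpace ℝ (Fin d)) :=
  convexHull ℝ (insert 0 (Set.range (euclideanBasis d)))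

theorem interior_cornerSimplex_nonempty (d : ℕ) : (interior (cornerSimplex d)).Nonempty := by
  rw [cornerSimplex, interior_convexHull_nonempty_iff_affineSpan_eq_top]
  apply SetLike.coe_injective
  rw [affineSpan_insert_zero, (euclideanBasis d).span_eq]
  rfl

/-- Up to an invertible affine map, a convex set of positive finite volume in `ℝ^d` contains the
corner simplex and is contained in the cube `[-2, 2]^d`. -/
theorem exists_affine_normalization {d : ℕ} {K : Set (EuclideanSpace ℝ (Fin d))}
    (hK : Convex ℝ K) (hpos : 0 < volume K) (hfin : volume K < ⊤) :
    ∃ (M : EuclideanSpace ℝ (Fin d) →ₗ[ℝ] EuclideanSpace ℝ (Fin d))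
      (p : EuclideanSpace ℝ (Fin d)), Function.Surjective M ∧
      cornerSimplex d ⊆ (fun x => p + M x) ⁻¹' K ∧
      ∀ x, p + M x ∈ K → ∀ i, |x i| ≤ 2 := by
  set b := euclideanBasis d
  obtain ⟨p, hp⟩ : (interior K).Nonempty := by
    rw [hK.interior_nonempty_iff_affineSpan_eq_top]
    by_contra h
    exact hpos.ne' (measure_mono_null (subset_affineSpan ℝ K)
      (Measure.addHaar_affineSubspace volume _ h))
  have hpK := interior_subset hp
  obtain ⟨r, hr, hball⟩ := Metric.isOpen_iff.1 isOpen_interior p hp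
  -- Near-maximal simplices: `w` gives the edge vectors at `p` of a simplex in `K`, whose volume is
  -- proportional to `|b.det w|`.
  let S : Set (Fin d → EuclideanSpace ℝ (Fin d)) := {w | ∀ i, p + w i ∈ K}
  have hdet : ∀ w, LinearMap.det (b.constr ℝ w) = b.det w := by
    intro w
    have h := b.det_comp (b.constr ℝ w) b
    rw [b.det_self, mul_one] at h
    rw [← h]
    congr 1
    ext1 i
    simp
  have hsimplex : ∀ w ∈ S, cornerSimplex d ⊆ (fun x => p + b.constr ℝ w x) ⁻¹' K := by
    intro w hw
    refine convexHull_min ?_ ?_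
    · rintro _ (rfl | ⟨i, rfl⟩)
      · simpa using hpK
      · simpa [b] using hw i
    · exact (hK.translate_preimage_right p).linear_preimage (b.constr ℝ w)
  have hvol : volume (cornerSimplex d) ≠ 0 :=
    (Measure.measure_pos_of_nonempty_interior _ (interior_cornerSimplex_nonempty d)).ne'
  have hbdd : BddAbove ((fun w => |b.det w|) '' S) := by
    refine ⟨(volume K / volume (cornerSimplex d)).toReal, ?_⟩
    rintro _ ⟨w, hw, rfl⟩
    have h1 := measure_mono (μ := volume) (image_subset_iff.2 (hsimplex w hw))
    rw [volume_image_affine, hdet] at h1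
    have htop : volume K / volume (cornerSimplex d) ≠ ⊤ := ENNReal.div_ne_top hfin.ne hvol
    rw [← ENNReal.ofReal_le_iff_le_toReal htop]
    exact ENNReal.le_div_iff_mul_le (Or.inl hvol) (Or.inr hfin.ne) |>.2 h1
  obtain ⟨w₀, hw₀, hw₀det⟩ : ∃ w ∈ S, 0 < |b.det w| := by
    refine ⟨fun i => (r / 2) • b i, fun i => interior_subset (hball ?_), ?_⟩
    · rw [Metric.mem_ball, dist_self_add_left, norm_smul, Real.norm_eq_abs,
        abs_of_pos (by positivity)]
      simp [b, hr]
    · rw [AlternatingMap.map_smul_univ b.det]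
      simp [b.det_self, hr.ne']
  set σ := sSup ((fun w => |b.det w|) '' S)
  have hσ : 0 < σ := hw₀det.trans_le (le_csSup hbdd ⟨w₀, hw₀, rfl⟩)
  -- `K` need not be closed, so the supremum may not be attained. Coming within a factor 2 of it is
  -- the source of the cube `[-2, 2]^d`.
  obtain ⟨_, ⟨w, hw, rfl⟩, hwσ⟩ := exists_lt_of_lt_csSup
    (Set.Nonempty.image (fun w => |b.det w|) ⟨w₀, hw₀⟩) (half_lt_self hσ)
  simp only at hwσ
  have hD : 0 < |b.det w| := (half_pos hσ).trans hwσ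
  refine ⟨b.constr ℝ w, p, ?_, hsimplex w hw, ?_⟩
  · have hu : IsUnit (LinearMap.det (b.constr ℝ w)) := by
      rw [hdet]
      exact (abs_pos.1 hD).isUnit
    exact ((Module.End.isUnit_iff _).1 (LinearMap.isUnit_iff_isUnit_det _ |>.2 hu)).2
  · intro x hx i
    -- Replacing the `i`-th edge by the image of `x` multiplies the determinant by `x i` (Cramer),
    -- so near-maximality bounds `|x i|`.
    have hmem : Function.update w i (b.constr ℝ w x) ∈ S := by
      intro j
      by_cases hj : j = i
      · subst hj; simpa using hx
      · simpa [hj] using hw j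
    have hle : |b.det (Function.update w i (b.constr ℝ w x))| ≤ σ :=
      le_csSup hbdd ⟨_, hmem, rfl⟩
    have hval : b.det (Function.update w i (b.constr ℝ w x)) = x i * b.det w := by
      have hx : b.constr ℝ w x = ∑ j, x j • w j := by
        rw [Module.Basis.constr_apply_fintype]
        simp [b]
      rw [hx, AlternatingMap.map_update_sum, Finset.sum_eq_single i]
      · rw [AlternatingMap.map_update_smul, Function.update_eq_self, smul_eq_mul]
      · intro j _ hji
        rw [AlternatingMap.map_update_smul, AlternatingMap.map_update_self _ _ hji.symm, smul_zero]
      · simp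
    rw [hval, abs_mul] at hle
    by_contra! h
    nlinarith

theorem encard_extremePoints_convexHull_le {d : ℕ} (V : Finset (EuclideanSpace ℝ (Fin d))) {N : ℕ}
    (hV : V.card ≤ N) :
    ((convexHull ℝ (V : Set (EuclideanSpace ℝ (Fin d)))).extremePoints ℝ).encard ≤ N := by
  refine (encard_le_encard extremePoints_convexHull_subset).trans ?_
  rw [encard_coe_eq_coe_finsetCard]
  exact_mod_cast hV

/-- Finitely many vertices, bounded in terms of `d` and `ε` only, suffice. -/
theorem exists_inscribedVolumeBound (d : ℕ) {ε : ℝ} (hε : 0 < ε) :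
    ∃ N, InscribedVolumeBound d ε N := by
  classical
  obtain ⟨c, hc⟩ := interior_cornerSimplex_nonempty d
  obtain ⟨r, hr, hball⟩ := Metric.nhds_basis_closedBall.mem_iff.1 (mem_interior_iff_mem_nhds.1 hc)
  obtain ⟨N, hN⟩ := exists_card_bound_of_ball_subset
    (volume : Measure (EuclideanSpace ℝ (Fin d))) c hr (2 * d) hε
  refine ⟨N, fun K hK hpos hfin => ?_⟩
  obtain ⟨M, p, hsurj, hsimplex, hbox⟩ := exists_affine_normalization hK hpos hfin
  obtain ⟨V, hVK, hVN, hvol⟩ := hN ((fun x => p + M x) ⁻¹' K) (hball.trans hsimplex) (by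
    intro x hx
    rw [mem_closedBall_zero_iff]
    have hx2 := hbox x hx
    have hsum : x = ∑ i, x i • euclideanBasis d i := by
      simpa using ((EuclideanSpace.basisFun (Fin d) ℝ).sum_repr x).symm
    rw [hsum]
    refine (norm_sum_le _ _).trans ?_
    refine (Finset.sum_le_card_nsmul _ _ 2 fun i _ => ?_).trans ?_
    · simpa [norm_smul] using hx2 i
    · simp [mul_comm])
  let φ : EuclideanSpace ℝ (Fin d) →ᵃ[ℝ] EuclideanSpace ℝ (Fin d) :=
    AffineMap.const ℝ _ p + M.toAffineMap
  have hφ : ⇑φ = fun x => p + M x := by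
    ext1 x
    simp [φ]
  have himg : convexHull ℝ ((V.image φ : Finset _) : Set (EuclideanSpace ℝ (Fin d)))
      = φ '' convexHull ℝ (V : Set (EuclideanSpace ℝ (Fin d))) := by
    rw [AffineMap.image_convexHull, Finset.coe_image]
  refine ⟨convexHull ℝ ((V.image φ : Finset _) : Set (EuclideanSpace ℝ (Fin d))), ⟨_, rfl⟩, ?_,
    encard_extremePoints_convexHull_le _ (Finset.card_image_le.trans hVN), ?_⟩
  · refine convexHull_min ?_ hK
    rw [Finset.coe_image, image_subset_iff, hφ]
    exact hVK
  · have hKimg : K = (fun x => p + M x) '' ((fun x => p + M x) ⁻¹' K) := by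
      refine (image_preimage_eq K fun y => ?_).symm
      obtain ⟨x, hx⟩ := hsurj (y - p)
      exact ⟨x, by simp [hx]⟩
    have hKvol := volume_image_affine M p ((fun x => p + M x) ⁻¹' K)
    rw [← hKimg] at hKvol
    rw [himg, hφ, hKvol, volume_image_affine, mul_left_comm]
    gcongr

end Approximation

/-! ### Rainbow polytopes, sharpness and the main theorem -/

/-- A polytope is the convex hull of its extreme points. -/
theorem IsConvexPolytope.convexHull_extremePoints {d : ℕ} {P : Set (EuclideanSpace ℝ (Fin d))}
    (hP : IsConvexPolytope P) : convexHull ℝ (P.extremePoints ℝ) = P := by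
  obtain ⟨V, rfl⟩ := hP
  have hfin := V.finite_toSet.subset (extremePoints_convexHull_subset (𝕜 := ℝ))
  rw [← (hfin.isClosed_convexHull (𝕜 := ℝ)).closure_eq]
  exact closure_convexHull_extremePoints (V.finite_toSet.isCompact_convexHull (𝕜 := ℝ))
    (convex_convexHull _ _)

/-- If the convex hull of each of `d * n` sets `X i` contains a polytope with at most `n`
vertices and non-empty interior, then the convex hull of some rainbow choice contains it. -/
theorem exists_rainbow_polytope_superset {d n : ℕ} {P : Set (EuclideanSpace ℝ (Fin d))}
    (hP : IsConvexPolytope P) (hcard : (P.extremePoints ℝ).encard ≤ n)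
    (hint : (interior P).Nonempty) (X : Fin (d * n) → Set (EuclideanSpace ℝ (Fin d)))
    (hd : 0 < d) (hX : ∀ i, P ⊆ convexHull ℝ (X i)) :
    ∃ x : Fin (d * n) → EuclideanSpace ℝ (Fin d), (∀ i, x i ∈ X i) ∧
      P ⊆ convexHull ℝ (Set.range x) := by
  obtain ⟨q, hq⟩ := hint
  have hPne : P.Nonempty := ⟨q, interior_subset hq⟩
  have hhull := hP.convexHull_extremePoints
  have hext : (P.extremePoints ℝ).Nonempty := by
    rw [← convexHull_nonempty_iff (𝕜 := ℝ), hhull]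
    exact hPne
  have hfin : (P.extremePoints ℝ).Finite :=
    Set.finite_of_encard_le_coe hcard
  have : Nonempty (P.extremePoints ℝ) := hext.to_subtype
  have : Fintype (P.extremePoints ℝ) := hfin.fintype
  -- Repetitions are allowed, so that each of the `n` blocks of `d` colours is assigned a vertex.
  obtain ⟨w, hw⟩ : ∃ w : Fin n → P.extremePoints ℝ, Function.Surjective w := by
    have hc : Fintype.card (P.extremePoints ℝ) ≤ Fintype.card (Fin n) := by
      rw [Fintype.card_fin]
      have h := hcard
      rw [encard_eq_coe_toFinset_card, toFinset_card] at h
      exact_mod_cast h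
    obtain ⟨g⟩ := Function.Embedding.nonempty_of_card_le hc
    exact ⟨Function.invFun g, Function.invFun_surjective g.injective⟩
  have hn : 0 < n := (hw (Classical.arbitrary _)).choose.pos
  have hchoice : ∀ j : Fin n, ∃ v : Fin d → EuclideanSpace ℝ (Fin d),
      (∀ i, v i ∈ X (finProdFinEquiv (i, j))) ∧
        (w j : EuclideanSpace ℝ (Fin d)) ∈ convexHull ℝ (insert q (Set.range v)) := fun j =>
    colorful_caratheodory_insert (by simp) (fun i => X (finProdFinEquiv (i, j))) _ q
      fun i => hX _ (extremePoints_subset (w j).2)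
  choose v hvX hv using hchoice
  refine ⟨fun k => v (finProdFinEquiv.symm k).2 (finProdFinEquiv.symm k).1, fun k => ?_, ?_⟩
  · have h := hvX (finProdFinEquiv.symm k).2 (finProdFinEquiv.symm k).1
    rwa [Prod.mk.eta, Equiv.apply_symm_apply] at h
  · rw [← hhull] at hq ⊢
    refine convexHull_subset_of_subset_convexHull_insert (Set.finite_range _) ?_ hq ?_
    · exact ⟨_, ⟨finProdFinEquiv (⟨0, hd⟩, ⟨0, hn⟩), rfl⟩⟩
    · intro y hy
      obtain ⟨j, hj⟩ := hw ⟨y, hy⟩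
      have h1 := hv j
      rw [hj] at h1
      refine convexHull_mono (insert_subset_insert ?_) h1
      rintro _ ⟨i, rfl⟩
      exact ⟨finProdFinEquiv (i, j), by simp⟩

open scoped Pointwise in
/-- Below the threshold some convex body of volume one is badly approximated by all polytopes. -/
theorem exists_volume_one_of_not_inscribedVolumeBound {d m : ℕ} {ε : ℝ} (hd : 0 < d)
    (h : ¬ InscribedVolumeBound d ε m) :
    ∃ K : Set (EuclideanSpace ℝ (Fin d)), Convex ℝ K ∧ volume K = 1 ∧
      ∀ V : Finset (EuclideanSpace ℝ (Fin d)), ↑V ⊆ K → V.card ≤ m →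
        volume (convexHull ℝ (V : Set (EuclideanSpace ℝ (Fin d)))) < ENNReal.ofReal (1 - ε) := by
  classical
  simp only [InscribedVolumeBound] at h
  push Not at h
  obtain ⟨K, hK, hpos, hfin, hbad⟩ := h
  have hvpos : 0 < (volume K).toReal := ENNReal.toReal_pos hpos.ne' hfin.ne
  -- the scaling factor with `s ^ d * vol K = 1`
  obtain ⟨s, hs, hsd⟩ : ∃ s : ℝ, 0 < s ∧ s ^ d = (volume K).toReal⁻¹ :=
    ⟨(volume K).toReal⁻¹ ^ ((d : ℝ)⁻¹), by positivity,
      Real.rpow_inv_natCast_pow (by positivity) hd.ne'⟩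
  have hscale : ∀ S : Set (EuclideanSpace ℝ (Fin d)),
      volume (s • S) = volume S / volume K := by
    intro S
    rw [Measure.addHaar_smul, finrank_euclideanSpace_fin, hsd, abs_of_pos (by positivity),
      ENNReal.ofReal_inv_of_pos hvpos, ENNReal.ofReal_toReal hfin.ne, mul_comm, div_eq_mul_inv]
  refine ⟨s • K, hK.smul s, ?_, fun V hV hVm => ?_⟩
  · rw [hscale, ENNReal.div_self hpos.ne' hfin.ne]
  · let W : Finset (EuclideanSpace ℝ (Fin d)) := V.image (s⁻¹ • ·)
    have hVW : (V : Set (EuclideanSpace ℝ (Fin d))) = s • (W : Set (EuclideanSpace ℝ (Fin d))) := by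
      rw [Finset.coe_image, image_smul, smul_inv_smul₀ hs.ne']
    have hWK : convexHull ℝ (W : Set (EuclideanSpace ℝ (Fin d))) ⊆ K := by
      refine convexHull_min ?_ hK
      rw [hVW] at hV
      exact (Set.smul_set_subset_smul_set_iff₀ hs.ne').1 hV
    have := hbad _ ⟨W, rfl⟩ hWK
      (encard_extremePoints_convexHull_le W (Finset.card_image_le.trans hVm))
    rw [hVW, convexHull_smul, hscale]
    exact ENNReal.div_lt_of_lt_mul this

theorem theorem2p4 (d : ℕ) (hd : 0 < d) (ε : ℝ) (hε : 0 < ε) :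
    (∀ (X : Fin (d * inscribedVertexNumber d ε) → Set (EuclideanSpace ℝ (Fin d)))
        (K : Set (EuclideanSpace ℝ (Fin d))),
      Convex ℝ K → volume K = 1 → K ⊆ ⋂ i, convexHull ℝ (X i) →
        ∃ x : Fin (d * inscribedVertexNumber d ε) → EuclideanSpace ℝ (Fin d),
          (∀ i, x i ∈ X i) ∧
            ENNReal.ofReal (1 - ε) ≤ volume (convexHull ℝ (Set.range x))) ∧
    (∀ m : ℕ, m < inscribedVertexNumber d ε →
      ∃ (X : Fin m → Set (EuclideanSpace ℝ (Fin d))) (K : Set (EuclideanSpace ℝ (Fin d))),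
        Convex ℝ K ∧ volume K = 1 ∧ K ⊆ ⋂ i, convexHull ℝ (X i) ∧
          ∀ x : Fin m → EuclideanSpace ℝ (Fin d), (∀ i, x i ∈ X i) →
            volume (convexHull ℝ (Set.range x)) < ENNReal.ofReal (1 - ε)) := by

  constructor
  · intro X K hK hvol hKX
    have hne : K.Nonempty := by
      rw [nonempty_iff_ne_empty]
      rintro rfl
      simp at hvol
    have hXi : ∀ i, K ⊆ convexHull ℝ (X i) := subset_iInter_iff.1 hKX
    -- In `ℕ`, `sInf ∅ = 0`; non-emptiness makes the infimum an admissible number of vertices.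
    have hbound : InscribedVolumeBound d ε (inscribedVertexNumber d ε) :=
      Nat.sInf_mem (exists_inscribedVolumeBound d hε)
    obtain ⟨P, hP, hPK, hcard, hvolP⟩ := hbound K hK (by simp [hvol]) (by simp [hvol])
    rw [hvol, mul_one] at hvolP
    -- Without interior there is no `q`, but then `1 - ε ≤ 0`.
    by_cases hP0 : volume P = 0
    · rw [hP0, nonpos_iff_eq_zero] at hvolP
      have hXne : ∀ i, (X i).Nonempty := fun i =>
        (convexHull_nonempty_iff (𝕜 := ℝ)).1 (hne.mono (hXi i))
      choose x hx using hXne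
      exact ⟨x, hx, by simp [hvolP]⟩
    · have hPconv : Convex ℝ P := by
        obtain ⟨V, rfl⟩ := hP
        exact convex_convexHull _ _
      have hint : (interior P).Nonempty := by
        rw [hPconv.interior_nonempty_iff_affineSpan_eq_top]
        by_contra h
        exact hP0 (measure_mono_null (subset_affineSpan ℝ P)
          (Measure.addHaar_affineSubspace volume _ h))
      obtain ⟨x, hx, hPx⟩ := exists_rainbow_polytope_superset hP hcard hint X hd
        fun i => hPK.trans (hXi i)
      exact ⟨x, hx, hvolP.trans (measure_mono hPx)⟩
  · intro m hm
    classical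
    obtain ⟨K, hK, hvol, hbad⟩ := exists_volume_one_of_not_inscribedVolumeBound hd
      (Nat.notMem_of_lt_sInf hm)
    refine ⟨fun _ => K, K, hK, hvol, subset_iInter fun _ => subset_convexHull ℝ K, fun x hx => ?_⟩
    have := hbad (Finset.univ.image x) (by simpa [range_subset_iff] using hx)
      (Finset.card_image_le.trans (by simp))
    simpa using this
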